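/- **Theorem 2.6.** Let $X$ be a real Banach space with dual $X^*$, and let $T:X\rightrightarrows X^*$ be a multivalued operator with graph $G(T)=\{(x,x^*)\in X\times X^*: x^*\in T(x)\}$ and domain $D_T=\{x\in X: T(x)\neq\emptyset\}$. Suppose that $T$ is maximal monotone, i.e. $\langle x^*-y^*,x-y\rangle\ge 0$ for all $(x,x^*),(y,y^*)\in G(T)$ and no monotone operator has a graph strictly containing $G(T)$. Suppose also that $T$ is of type (FPV): for every open convex set $U\subseteq X$ with $U\cap D_T\ne\emptyset$, if $(w,w^*)\in U\times X^*$ satisfies $\langle s^*-w^*,s-w\rangle\ge 0$ for all $(s,s^*)\in G(T)$ with $s\in U$, then $(w,w^*)\in G(T)$. Then $T$ is regular, that is, for all $(x,x^*)\in X\times X^*$, $$L(x,x^*,T)=d(x^*,T(x)),$$ where $$L(x,x^*,T)=\max\Bigl\{0,\ \sup\Bigl\{\frac{\langle y^*-x^*,x-y\rangle}{\|x-y\|} : y\neq x,\ (y,y^*)\in G(T)\Bigr\}\Bigr\}\in[0,\infty]$$ (with $\sup\emptyset=-\infty$) and $d(x^*,T(x))=\inf\{\|y^*-x^*\|: y^*\in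 T(x)\}\in[0,\infty]$ (with $\inf\emptyset=\infty$). -/

import Mathlib

/-!
Multivalued operators `T : X ⇉ X*` on a real normed space `X` are functions from `X` to sets of
continuous linear functionals on `X`.
-/

namespace MonotoneOp

variable {X : Type*} [NormedAddCommGroup X] [NormedSpace ℝ X]

/-- The graph `G(T) = {(x, x*) : x* ∈ T(x)}`. -/
def graph (T : X → Set (StrongDual ℝ X)) : Set (X × StrongDual ℝ X) :=
  {p | p.2 ∈ T p.1}

/-- The domain `D_T = {x : T(x) ≠ ∅}`. -/
def domain (T : X → Set (StrongDual ℝ X)) : Set X :=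
  {x | (T x).Nonempty}

/-- `T` is monotone: `⟨x* - y*, x - y⟩ ≥ 0` for all `(x, x*), (y, y*) ∈ G(T)`. -/
def IsMonotone (T : X → Set (StrongDual ℝ X)) : Prop :=
  ∀ p ∈ graph T, ∀ q ∈ graph T, 0 ≤ (p.2 - q.2) (p.1 - q.1)

/-- `T` is maximal monotone: it is monotone, and there is no monotone operator whose graph
strictly contains the graph of `T`. -/
def IsMaximalMonotone (T : X → Set (StrongDual ℝ X)) : Prop :=
  IsMonotone T ∧ ¬ ∃ S : X → Set (StrongDual ℝ X), IsMonotone S ∧ graph T ⊂ graph S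

/-- `T` is of type (FPV) (Fitzpatrick–Phelps–Veronas): for every open convex set `U` that meets
`D_T`, if `(w, w*) ∈ U × X*` satisfies `⟨s* - w*, s - w⟩ ≥ 0` for all `(s, s*) ∈ G(T)` with
`s ∈ U`, then `(w, w*) ∈ G(T)`. -/
def IsTypeFPV (T : X → Set (StrongDual ℝ X)) : Prop :=
  ∀ U : Set X, IsOpen U → Convex ℝ U → (U ∩ domain T).Nonempty →
    ∀ (w : X) (w' : StrongDual ℝ X), w ∈ U →
      (∀ p ∈ graph T, p.1 ∈ U → 0 ≤ (p.2 - w') (p.1 - w)) →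
      (w, w') ∈ graph T

/-- The number `L(x, x*, T) = sup {⟨y* - x*, x - y⟩ / ‖x - y‖ : y ≠ x, (y, y*) ∈ G(T)}`, where the
supremum is taken in `[0, ∞]`: it is `0` if the set is empty or consists of negative numbers. -/
noncomputable def L (x : X) (x' : StrongDual ℝ X) (T : X → Set (StrongDual ℝ X)) : EReal :=
  max 0 (sSup {r : EReal | ∃ (y : X) (y' : StrongDual ℝ X), y ≠ x ∧ (y, y') ∈ graph T ∧
    r = (((y' - x') (x - y) / ‖x - y‖ : ℝ) : EReal)})

/-- `T` is regular: `L(x, x*, T) = d(x*, T(x))` for all `(x, x*) ∈ X × X*`, where `d` is the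
distance to a set for the dual norm, with `d(x*, ∅) = ∞`. -/
def IsRegular (T : X → Set (StrongDual ℝ X)) : Prop :=
  ∀ (x : X) (x' : StrongDual ℝ X), L x x' T = ((Metric.infEDist x' (T x) : ENNReal) : EReal)

end MonotoneOp

namespace MonotoneOp

variable {X : Type*} [NormedAddCommGroup X] [NormedSpace ℝ X]

/-! The bound `L ≤ d` is monotonicity plus the operator norm estimate. For the converse let `lam =
L` be finite. By maximality it suffices to find `z` with `‖z‖ ≤ lam` such that `(x, x' + z)` is
monotonically related to the graph. Translate `(x, x')` to the origin and project the epigraph of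
the Fitzpatrick function of `T` to `X × ℝ`, forgetting the dual variable. The resulting convex set
`C` contains every `(a - x, ⟨a* - x', a - x⟩)`, so any linear functional below `C` is such a `z`.
Hahn–Banach (`exists_dual_le_of_le`) supplies one of norm at most `lam` once `C` lies above `-lam *
‖·‖`. This is where (FPV) enters: `exists_mem_graph_near` yields graph points near `x + s • y` with
nonpositive pairing, and letting `s → 0` gives the bound. -/

/-- A nonempty convex set in `X × ℝ` lying above the graph of `y ↦ -lam * ‖y‖` lies above the graph
of a continuous linear functional of norm at most `lam`. -/
theorem exists_dual_le_of_le {C : Set (X × ℝ)} (hC : Convex ℝ C) (hne : C.Nonempty) {lam : ℝ}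
    (hlam : 0 ≤ lam) (h : ∀ q ∈ C, -(lam * ‖q.1‖) ≤ q.2) :
    ∃ z : StrongDual ℝ X, ‖z‖ ≤ lam ∧ ∀ q ∈ C, z q.1 ≤ q.2 := by
  have hconv : Convex ℝ {q : X × ℝ | q.2 < -(lam * ‖q.1‖)} := by
    rintro ⟨u, r⟩ hu ⟨v, s⟩ hv a b ha hb hab
    simp only [Set.mem_ofPred_eq, Prod.smul_mk, Prod.mk_add_mk, smul_eq_mul] at *
    have h1 : ‖a • u + b • v‖ ≤ a * ‖u‖ + b * ‖v‖ := by
      simpa [norm_smul, abs_of_nonneg ha, abs_of_nonneg hb] using norm_add_le (a • u) (b • v)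
    have h2 := mul_le_mul_of_nonneg_left h1 hlam
    rcases ha.eq_or_lt with rfl | ha'
    · have : b = 1 := by linarith
      subst this
      simpa using hv
    · have h3 := mul_lt_mul_of_pos_left hu ha'
      have h4 := mul_le_mul_of_nonneg_left hv.le hb
      linarith
  have hopen : IsOpen {q : X × ℝ | q.2 < -(lam * ‖q.1‖)} :=
    isOpen_lt (by fun_prop) (by fun_prop)
  have hdisj : Disjoint {q : X × ℝ | q.2 < -(lam * ‖q.1‖)} C :=
    Set.disjoint_left.2 fun q hq hqC => absurd (h q hqC) (not_le.2 hq)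
  obtain ⟨f, s, hf, hs⟩ := geometric_hahn_banach_open hconv hopen hC hdisj
  set g : StrongDual ℝ X := f.comp (ContinuousLinearMap.inl ℝ X ℝ) with hg
  set k : ℝ := f (0, 1) with hk
  have hfk : ∀ (u : X) (r : ℝ), f (u, r) = g u + k * r := by
    intro u r
    have : ((u, r) : X × ℝ) = (u, 0) + r • (0, 1) := by simp
    rw [this, map_add, map_smul]
    simp [hg, hk, mul_comm]
  have hlt : ∀ (u : X) (r : ℝ), r < -(lam * ‖u‖) → g u + k * r < s := fun u r hr => by
    rw [← hfk]; exact hf (u, r) hr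
  have hge : ∀ q ∈ C, s ≤ g q.1 + k * q.2 := fun q hq => by
    rw [← hfk]; exact hs q hq
  have hs0 : 0 ≤ s := by
    refine le_of_forall_pos_lt_add fun e he => ?_
    have := hlt 0 (-(e / (|k| + 1))) (by simp; positivity)
    have h2 : k * (e / (|k| + 1)) ≤ e := by
      rw [← mul_div_assoc, div_le_iff₀ (by positivity)]
      nlinarith [le_abs_self k]
    simp only [map_zero] at this
    linarith
  have hk0 : 0 ≤ k := by
    by_contra! hneg
    have := hlt 0 (-(1 + s / (-k))) (by
      have : 0 ≤ s / (-k) := div_nonneg hs0 (by linarith)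
      simp; linarith)
    have h2 : k * (s / (-k)) = -s := by rw [div_neg, mul_neg, mul_div_cancel₀ _ hneg.ne]
    simp only [map_zero] at this
    linarith
  -- A vertical hyperplane is impossible: the hypograph projects onto all of `X`, including the
  -- first coordinate of a point of `C`.
  have hkpos : 0 < k := by
    refine lt_of_le_of_ne hk0 fun hk' => ?_
    have hlt' : ∀ u, g u < s := fun u => by
      have := hlt u (-(lam * ‖u‖) - 1) (by linarith)
      simpa [← hk'] using this
    obtain ⟨q, hq⟩ := hne
    have := hge q hq
    have h2 := hlt' q.1
    rw [← hk'] at this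
    linarith
  have hgle : ∀ u, g u ≤ lam * k * ‖u‖ := by
    intro u
    have hle : ∀ v, g v - k * (lam * ‖v‖) ≤ s + k := fun v => by
      have := hlt v (-(lam * ‖v‖) - 1) (by linarith)
      linarith
    by_contra! hlt'
    have hd : 0 < g u - k * (lam * ‖u‖) := by linarith
    set d := g u - k * (lam * ‖u‖)
    -- The excess `d` is positively homogeneous in `u`; this scaling raises it to `s + k + 1`, above
    -- the bound `s + k`.
    have h1 := hle (((s + k + 1) / d) • u)
    have hpos : 0 ≤ (s + k + 1) / d := by positivity
    rw [map_smul, norm_smul, Real.norm_of_nonneg hpos, smul_eq_mul] at h1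
    have h2 : (s + k + 1) / d * d = s + k + 1 := div_mul_cancel₀ _ hd.ne'
    have h3 : (s + k + 1) / d * d = (s + k + 1) / d * g u
        - k * (lam * ((s + k + 1) / d * ‖u‖)) := by ring
    linarith
  refine ⟨-(k⁻¹ • g), ContinuousLinearMap.opNorm_le_bound _ hlam fun u => ?_, fun q hq => ?_⟩
  · have h1 := hgle u
    have h2 := hgle (-u)
    rw [map_neg, norm_neg] at h2
    have h3 : |g u| ≤ lam * k * ‖u‖ := abs_le.2 ⟨by linarith, h1⟩
    have h4 : ‖(-(k⁻¹ • g)) u‖ = k⁻¹ * |g u| := by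
      simp [abs_of_pos hkpos]
    rw [h4, inv_mul_le_iff₀ hkpos]
    linarith
  · have h1 := hge q hq
    have h4 : (-(k⁻¹ • g)) q.1 = k⁻¹ * (-g q.1) := by simp
    rw [h4, inv_mul_le_iff₀ hkpos]
    linarith

/-- If `T` is of type (FPV) and `⟨a*, a - w⟩` is bounded below on bounded parts of the graph, then
every neighbourhood of `w` contains some `a` with `(a, a*) ∈ G(T)` and `⟨a* - w*, a - w⟩ ≤ 0`. -/
theorem IsTypeFPV.exists_mem_graph_near {T : X → Set (StrongDual ℝ X)} (hFPV : IsTypeFPV T)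
    (hne : (graph T).Nonempty) (w : X) (w' : StrongDual ℝ X)
    (hbd : ∀ R : ℝ, ∃ K : ℝ, ∀ p ∈ graph T, ‖p.1 - w‖ ≤ R → -K ≤ p.2 (p.1 - w))
    {e : ℝ} (he : 0 < e) :
    ∃ p ∈ graph T, ‖p.1 - w‖ < e ∧ (p.2 - w') (p.1 - w) ≤ 0 := by
  have near : (Metric.ball w e ∩ domain T).Nonempty := by
    by_contra hempty
    have hfar : ∀ p ∈ graph T, e ≤ ‖p.1 - w‖ := by
      intro p hp
      by_contra! hlt
      exact hempty ⟨p.1, by simpa [dist_eq_norm] using hlt, ⟨p.2, hp⟩⟩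
    obtain ⟨b, hb⟩ := hne
    have hbw := hfar b hb
    have hb0 : b.1 - w ≠ 0 := fun h0 => by
      rw [h0, norm_zero] at hbw; linarith
    obtain ⟨g, hg1, hgb⟩ := exists_dual_vector ℝ (b.1 - w) (norm_ne_zero_iff.2 hb0)
    simp only [RCLike.ofReal_real_eq_id, id_eq] at hgb
    obtain ⟨K, hK⟩ := hbd (‖b.1 - w‖ + e)
    set U : Set X := Metric.thickening (e / 4) (segment ℝ w b.1)
    have hU : ∀ u ∈ U, ‖u - w‖ ≤ ‖b.1 - w‖ + e ∧ ‖u - w‖ - e / 2 ≤ g (u - w) := by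
      intro u hu
      obtain ⟨v, hv, huv⟩ := Metric.mem_thickening_iff.1 hu
      rw [segment_eq_image'] at hv
      obtain ⟨t, ⟨ht0, ht1⟩, rfl⟩ := hv
      rw [dist_eq_norm] at huv
      set r := u - (w + t • (b.1 - w)) with hr
      have hu' : u - w = t • (b.1 - w) + r := by rw [hr]; abel
      have h1 : ‖u - w‖ ≤ t * ‖b.1 - w‖ + ‖r‖ := by
        rw [hu']
        simpa [norm_smul, abs_of_nonneg ht0] using norm_add_le (t • (b.1 - w)) r
      have h2 : g (u - w) = t * ‖b.1 - w‖ + g r := by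
        rw [hu', map_add, map_smul, hgb, smul_eq_mul]
      have h3 : |g r| ≤ ‖r‖ := by simpa [hg1] using g.le_opNorm r
      have h4 := (abs_le.1 h3).1
      have h5 : t * ‖b.1 - w‖ ≤ ‖b.1 - w‖ := mul_le_of_le_one_left (norm_nonneg _) ht1
      exact ⟨by linarith, by linarith⟩
    have hwU : w ∈ U := Metric.self_subset_thickening (by positivity) _ (left_mem_segment ℝ w b.1)
    have hbU : b.1 ∈ U :=
      Metric.self_subset_thickening (by positivity) _ (right_mem_segment ℝ w b.1)
    -- On the tube `U`, `g (a - w) ≥ ‖a - w‖ - e / 2 ≥ e / 2` at graph points, so the multiple `2 *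
    -- |K| / e` of `g` outweighs the lower bound `-K`.
    have hmem := hFPV U Metric.isOpen_thickening ((convex_segment w b.1).thickening _)
      ⟨b.1, hbU, ⟨b.2, hb⟩⟩ w (-((2 * |K| / e) • g)) hwU (by
        intro p hp hpU
        obtain ⟨h1, h2⟩ := hU p.1 hpU
        have h3 := hK p hp h1
        have h4 := hfar p hp
        have h5 : 2 * |K| / e * (e / 2) ≤ 2 * |K| / e * g (p.1 - w) :=
          mul_le_mul_of_nonneg_left (by linarith) (by positivity)
        have h6 : 2 * |K| / e * (e / 2) = |K| := by field_simp
        have h7 := le_abs_self K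
        simp only [sub_neg_eq_add, add_apply, smul_apply,
          smul_eq_mul]
        linarith)
    have := hfar _ hmem
    simp only [sub_self, norm_zero] at this
    linarith
  by_contra! hcon
  have hmem : (w, w') ∈ graph T := hFPV (Metric.ball w e) Metric.isOpen_ball (convex_ball w e) near
    w w' (Metric.mem_ball_self he) fun p hp hpU =>
      (hcon p hp (by simpa [dist_eq_norm] using hpU)).le
  simpa using hcon _ hmem (by simpa using he)

/-- If `⟨a* - x*, x - a⟩ ≤ lam * ‖a - x‖` on the graph of a monotone operator `T` of type (FPV),
then some `z*` with `‖z* - x*‖ ≤ lam` is such that `(x, z*)` is monotonically related to `T`. -/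
theorem IsTypeFPV.exists_monotonically_related {T : X → Set (StrongDual ℝ X)}
    (hFPV : IsTypeFPV T) (hmon : IsMonotone T) (hne : (graph T).Nonempty) (x : X)
    (x' : StrongDual ℝ X) {lam : ℝ} (hlam : 0 ≤ lam)
    (hbd : ∀ p ∈ graph T, -(lam * ‖p.1 - x‖) ≤ (p.2 - x') (p.1 - x)) :
    ∃ z' : StrongDual ℝ X, ‖z' - x'‖ ≤ lam ∧ ∀ p ∈ graph T, 0 ≤ (p.2 - z') (p.1 - x) := by
  set C : Set (X × ℝ) := {q | ∃ v : StrongDual ℝ X, ∀ p ∈ graph T,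
    (p.2 - x') q.1 + v (p.1 - x) - (p.2 - x') (p.1 - x) ≤ q.2} with hCdef
  have hgC : ∀ p ∈ graph T, (p.1 - x, (p.2 - x') (p.1 - x)) ∈ C := by
    refine fun p hp => ⟨p.2 - x', fun a ha => ?_⟩
    have := hmon p hp a ha
    simp only [sub_apply, map_sub] at this ⊢
    linarith
  have hC : Convex ℝ C := by
    rintro ⟨y, c⟩ ⟨v, hv⟩ ⟨z, d⟩ ⟨u, hu⟩ a b ha hb hab
    refine ⟨a • v + b • u, fun p hp => ?_⟩
    have h1 := mul_le_mul_of_nonneg_left (hv p hp) ha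
    have h2 := mul_le_mul_of_nonneg_left (hu p hp) hb
    have h3 : (p.2 - x') (p.1 - x) = a * (p.2 - x') (p.1 - x) + b * (p.2 - x') (p.1 - x) := by
      rw [← add_mul, hab, one_mul]
    simp only [Prod.smul_mk, Prod.mk_add_mk, map_add, map_smul, smul_eq_mul,
      add_apply, smul_apply] at h1 h2 ⊢
    linarith
  have hCbd : ∀ q ∈ C, -(lam * ‖q.1‖) ≤ q.2 := by
    rintro ⟨y, c⟩ ⟨v, hv⟩
    dsimp only at hv ⊢
    have key : ∀ s ∈ Set.Ioo (0 : ℝ) 1, ∀ e > 0,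
        -((1 - s) * (lam * (s * ‖y‖ + e))) + s * (s * v y - ‖v‖ * e) ≤ s * c := by
      rintro s ⟨hs0, hs1⟩ e he
      -- Weights `s` on the inequality defining `C` and `1 - s` on `hbd` recentre the pairing at `x
      -- + s • y`.
      have hlow : ∀ p ∈ graph T, s * (v (p.1 - x) - c) - (1 - s) * (lam * ‖p.1 - x‖)
          ≤ (p.2 - x') (p.1 - (x + s • y)) := by
        intro p hp
        have h1 := mul_le_mul_of_nonneg_left (hv p hp) hs0.le
        have h2 := mul_le_mul_of_nonneg_left (hbd p hp) (sub_nonneg.2 hs1.le)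
        have h3 : (p.2 - x') (p.1 - (x + s • y)) = (p.2 - x') (p.1 - x) - s * (p.2 - x') y := by
          rw [← sub_sub, map_sub, map_smul, smul_eq_mul]
        linarith
      obtain ⟨p, hp, hpn, hpw⟩ := hFPV.exists_mem_graph_near hne (x + s • y) x' (by
        intro R
        refine ⟨s * (‖v‖ * (R + ‖s • y‖) + c) + (1 - s) * (lam * (R + ‖s • y‖)) + ‖x'‖ * R,
          fun p hp hpR => ?_⟩
        have h0 := hlow p hp
        have h1 : ‖p.1 - x‖ ≤ R + ‖s • y‖ := by
          have : p.1 - x = (p.1 - (x + s • y)) + s • y := by abel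
          rw [this]
          exact (norm_add_le _ _).trans (by linarith)
        have h2 : |v (p.1 - x)| ≤ ‖v‖ * (R + ‖s • y‖) :=
          (v.le_opNorm _).trans (mul_le_mul_of_nonneg_left h1 (norm_nonneg _))
        have h3 : |x' (p.1 - (x + s • y))| ≤ ‖x'‖ * R :=
          (x'.le_opNorm _).trans (mul_le_mul_of_nonneg_left hpR (norm_nonneg _))
        have h4 := mul_le_mul_of_nonneg_left (abs_le.1 h2).1 hs0.le
        have h5 := mul_le_mul_of_nonneg_left (mul_le_mul_of_nonneg_left h1 hlam)
          (sub_nonneg.2 hs1.le)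
        have h6 := (abs_le.1 h3).1
        rw [sub_apply] at h0
        linarith) he
      have hsplit : p.1 - x = (p.1 - (x + s • y)) + s • y := by abel
      have h1 : ‖p.1 - x‖ ≤ s * ‖y‖ + e := by
        rw [hsplit]
        refine (norm_add_le _ _).trans ?_
        rw [norm_smul, Real.norm_of_nonneg hs0.le]
        linarith
      have h2 : s * v y - ‖v‖ * e ≤ v (p.1 - x) := by
        have h3 : |v (p.1 - (x + s • y))| ≤ ‖v‖ * e :=
          (v.le_opNorm _).trans (mul_le_mul_of_nonneg_left hpn.le (norm_nonneg _))
        have h4 := (abs_le.1 h3).1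
        rw [hsplit, map_add, map_smul, smul_eq_mul]
        linarith
      have h3 := hlow p hp
      have h4 := mul_le_mul_of_nonneg_left h2 hs0.le
      have h5 := mul_le_mul_of_nonneg_left (mul_le_mul_of_nonneg_left h1 hlam)
        (sub_nonneg.2 hs1.le)
      linarith
    -- Let `e → 0` with `s` fixed, so that a factor `s` cancels; only then let `s → 0`, which
    -- removes `v`.
    have key' : ∀ s ∈ Set.Ioo (0 : ℝ) 1, -((1 - s) * (lam * ‖y‖)) + s * v y ≤ c := by
      intro s hs
      have hlim : -((1 - s) * (lam * (s * ‖y‖ + 0))) + s * (s * v y - ‖v‖ * 0) ≤ s * c := by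
        refine le_of_tendsto (f := fun e : ℝ => -((1 - s) * (lam * (s * ‖y‖ + e))) +
          s * (s * v y - ‖v‖ * e)) (x := nhdsWithin 0 (Set.Ioi 0)) ?_
          (eventually_mem_nhdsWithin.mono fun e he => key s hs e he)
        exact (Continuous.tendsto (by fun_prop) 0).mono_left nhdsWithin_le_nhds
      refine le_of_mul_le_mul_left ?_ hs.1
      linarith
    have hlim : -((1 - 0) * (lam * ‖y‖)) + 0 * v y ≤ c := by
      refine le_of_tendsto (f := fun s : ℝ => -((1 - s) * (lam * ‖y‖)) + s * v y)
        (x := nhdsWithin 0 (Set.Ioi 0)) ?_ ?_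
      · exact (Continuous.tendsto (by fun_prop) 0).mono_left nhdsWithin_le_nhds
      · filter_upwards [Ioo_mem_nhdsGT (zero_lt_one' ℝ)] with s hs using key' s hs
    linarith
  obtain ⟨p₀, hp₀⟩ := hne
  obtain ⟨z, hz, hzC⟩ := exists_dual_le_of_le hC ⟨_, hgC p₀ hp₀⟩ hlam hCbd
  refine ⟨x' + z, by simpa using hz, fun p hp => ?_⟩
  have := hzC _ (hgC p hp)
  rw [← sub_sub, sub_apply]
  exact sub_nonneg.2 this

/-- A point monotonically related to a maximal monotone operator belongs to its graph. -/
theorem IsMaximalMonotone.mem_graph {T : X → Set (StrongDual ℝ X)} (hT : IsMaximalMonotone T)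
    {x : X} {x' : StrongDual ℝ X} (h : ∀ p ∈ graph T, 0 ≤ (p.2 - x') (p.1 - x)) :
    (x, x') ∈ graph T := by
  by_contra hx
  refine hT.2 ⟨fun y => {y' | y' ∈ T y ∨ (y = x ∧ y' = x')}, ?_,
    fun p hp => Or.inl hp, fun hsub => hx (hsub (Or.inr ⟨rfl, rfl⟩))⟩
  rintro ⟨p, p'⟩ (hp | ⟨rfl, rfl⟩) ⟨q, q'⟩ (hq | ⟨rfl, rfl⟩)
  · exact hT.1 _ hp _ hq
  · exact h _ hp
  · have := h _ hq
    simp only [sub_apply, map_sub] at this ⊢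
    linarith
  · simp

theorem IsMaximalMonotone.graph_nonempty {T : X → Set (StrongDual ℝ X)}
    (hT : IsMaximalMonotone T) : (graph T).Nonempty := by
  by_contra hne
  have hempty : ∀ p, p ∉ graph T := fun p hp => hne ⟨p, hp⟩
  exact hempty _ (hT.mem_graph (x := 0) (x' := 0) fun p hp => absurd hp (hempty p))

/-- The inequality `L(x, x*, T) ≤ d(x*, T(x))`, valid for every monotone operator. -/
theorem IsMonotone.L_le_infEDist {T : X → Set (StrongDual ℝ X)} (hT : IsMonotone T) (x : X)
    (x' : StrongDual ℝ X) : L x x' T ≤ ((Metric.infEDist x' (T x) : ENNReal) : EReal) := by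
  refine max_le (EReal.coe_ennreal_nonneg _) (sSup_le ?_)
  rintro r ⟨y, y', hyx, hy, rfl⟩
  have hle : ENNReal.ofReal ((y' - x') (x - y) / ‖x - y‖) ≤ Metric.infEDist x' (T x) := by
    refine Metric.le_infEDist.2 fun z' hz => ?_
    rw [edist_dist]
    refine ENNReal.ofReal_le_ofReal ?_
    have hpos : 0 < ‖x - y‖ := norm_pos_iff.2 (sub_ne_zero.2 hyx.symm)
    rw [div_le_iff₀ hpos, dist_comm, dist_eq_norm]
    have h1 := hT (x, z') hz (y, y') hy
    have h2 := (le_abs_self _).trans ((z' - x').le_opNorm (x - y))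
    simp only [sub_apply] at h1 h2 ⊢
    linarith
  calc (((y' - x') (x - y) / ‖x - y‖ : ℝ) : EReal)
      ≤ ((ENNReal.ofReal ((y' - x') (x - y) / ‖x - y‖) : ENNReal) : EReal) := by
        rw [EReal.coe_ennreal_ofReal]
        exact EReal.coe_le_coe_iff.2 (le_max_left _ _)
    _ ≤ _ := EReal.coe_ennreal_le_coe_ennreal_iff.2 hle

/-- The inequality `d(x*, T(x)) ≤ L(x, x*, T)` for maximal monotone operators of type (FPV). -/
theorem IsTypeFPV.infEDist_le_L {T : X → Set (StrongDual ℝ X)} (hFPV : IsTypeFPV T) (hT : IsMaximalMonotone T) (x : X)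
    (x' : StrongDual ℝ X) : ((Metric.infEDist x' (T x) : ENNReal) : EReal) ≤ L x x' T := by
  have h0 : 0 ≤ L x x' T := le_max_left _ _
  by_cases htop : L x x' T = ⊤
  · rw [htop]; exact le_top
  have hbot : L x x' T ≠ ⊥ := ((EReal.bot_lt_zero).trans_le h0).ne'
  obtain ⟨lam, hlam⟩ : ∃ lam : ℝ, (lam : EReal) = L x x' T :=
    ⟨_, EReal.coe_toReal htop hbot⟩
  rw [← hlam] at h0 ⊢
  have hlam0 : 0 ≤ lam := EReal.coe_nonneg.1 h0
  obtain ⟨z', hz, hrel⟩ := hFPV.exists_monotonically_related hT.1 hT.graph_nonempty x x' hlam0 (by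
    intro p hp
    rcases eq_or_ne p.1 x with hpx | hpx
    · simp [hpx]
    have h1 : (((p.2 - x') (x - p.1) / ‖x - p.1‖ : ℝ) : EReal) ≤ (lam : EReal) := by
      rw [hlam]
      exact le_max_of_le_right (le_sSup ⟨p.1, p.2, hpx, hp, rfl⟩)
    rw [EReal.coe_le_coe_iff, div_le_iff₀ (norm_pos_iff.2 (sub_ne_zero.2 hpx.symm)),
      ← neg_sub p.1 x, map_neg, norm_neg] at h1
    linarith)
  have hmem : z' ∈ T x := hT.mem_graph hrel
  calc ((Metric.infEDist x' (T x) : ENNReal) : EReal)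
      ≤ ((ENNReal.ofReal lam : ENNReal) : EReal) := by
        refine EReal.coe_ennreal_le_coe_ennreal_iff.2 ?_
        refine (Metric.infEDist_le_edist_of_mem hmem).trans ?_
        rw [edist_dist, dist_comm, dist_eq_norm]
        exact ENNReal.ofReal_le_ofReal hz
    _ = lam := by rw [EReal.coe_ennreal_ofReal, max_eq_left hlam0]

end MonotoneOp

theorem theorem2p6 {X : Type*} [NormedAddCommGroup X] [NormedSpace ℝ X] [CompleteSpace X]
    (T : X → Set (StrongDual ℝ X)) (hT : MonotoneOp.IsMaximalMonotone T)
    (hFPV : MonotoneOp.IsTypeFPV T) : MonotoneOp.IsRegular T :=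
  fun x x' => le_antisymm (hT.1.L_le_infEDist x x') (hFPV.infEDist_le_L hT x x')
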